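/- A monic polynomial $g(x)\in\mathbb{Z}[x]$ that is irreducible over $\mathbb{Q}$ is called monogenic (and only such polynomials are) if $[\mathbb{Z}_K:\mathbb{Z}[\theta]]=1$, where $\theta$ is a root of $g$, $K=\mathbb{Q}(\theta)$ and $\mathbb{Z}_K$ is the ring of algebraic integers of $K$. Let $m\in\mathbb{Z}$ and $f(x)=x^3-mx^2-(m+3)x-1$. Let $k$ be a positive integer such that $f(x)$ is reducible modulo every odd prime $p\mid k$. Then $f(x^k)$ is monogenic if and only if (i) $f(x)$ is monogenic, and (ii) for every odd prime $p\mid k$ and every $r=1,\ldots,p-2$, $$m\not\equiv\frac{r^{3p}-3r^p-1}{r^p(r^p+1)}\pmod{p^2},$$ where the fraction is taken in $\mathbb{Z}/p^2\mathbb{Z}$ (its denominator is invertible there). -/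

import Mathlib

open Polynomial

noncomputable section

/-- The field `K = ℚ(θ) = ℚ[x] / (f)` generated by a root `θ` of `f ∈ ℤ[x]`
(it is a field when `f` is irreducible over `ℚ`). -/
abbrev RootField (f : ℤ[X]) : Type :=
  AdjoinRoot (f.map (Int.castRingHom ℚ))

/-- The root `θ` of `f` in `K = ℚ(θ)`. -/
abbrev rootOf (f : ℤ[X]) : RootField f :=
  AdjoinRoot.root (f.map (Int.castRingHom ℚ))

/-- The index `[ℤ_K : ℤ[θ]]` of a monic irreducible `f ∈ ℤ[x]`, where `θ` is a root of `f`,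
`K = ℚ(θ)`, and `ℤ_K` is the ring of algebraic integers of `K`
(the value is `0` if the index is infinite). -/
def polyIndex (f : ℤ[X]) : ℕ :=
  (Subalgebra.toSubmodule (Algebra.adjoin ℤ {rootOf f})).toAddSubgroup.relIndex
    (Subalgebra.toSubmodule (integralClosure ℤ (RootField f))).toAddSubgroup

/-- `f ∈ ℤ[x]` is monogenic: it is monic, irreducible over `ℚ`, and its index is `1`. -/
def IsMonogenic (f : ℤ[X]) : Prop :=
  f.Monic ∧ Irreducible (f.map (Int.castRingHom ℚ)) ∧ polyIndex f = 1

/-- The simplest cubic `x³ - m x² - (m + 3) x - 1`. -/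
def simplestCubic (m : ℤ) : ℤ[X] :=
  X ^ 3 - C m * X ^ 2 - C (m + 3) * X - 1

end

noncomputable section

/-! For monic `F` irreducible over ℚ, ℤ[θ] = ℤ[X]/(F) is integrally closed iff it is regular at each
maximal ideal, that is, iff `F ∉ N ^ 2` for every maximal `N` of ℤ[X]
(`polyIndex_eq_one_iff_forall_notMem_sq`). It remains to compare f and f(x^k) under this test.

Lying over for x ↦ x^k carries f ∈ N² up to f(x^k) ∈ N'². Conversely, let f(x^k) ∈ N² and p ∈ N. If
p ∤ k, the map is unramified at N, because f(0) = -1 keeps x out of N, so membership descends to f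
(`mem_comap_expand_sq`). If p is odd and p ∣ k, then f has a root mod p, hence all of them, and z ≡
r mod N gives f(z^p) ≡ f(r^p) mod N²; the obstruction is p² ∣ f(r^p), which solved for m is (ii).
For p = 2 ∣ k membership never occurs.

Irreducibility of f(x^k) amounts to that of x^k - θ over ℚ(θ). Real embeddings of both signs show
that ±θ are not squares, and (ii) prevents θ from being a p-th power for odd p ∣ k
(`pow_ne_rootOf`). -/

theorem Ideal.mem_span_pair_sq {R : Type*} [CommRing R] {a b x : R} :
    x ∈ Ideal.span {a, b} ^ 2 ↔ ∃ u v w, x = a ^ 2 * u + a * b * v + b ^ 2 * w := by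
  constructor
  · intro hx
    rw [pow_two] at hx
    induction hx using Submodule.mul_induction_on' with
    | mem_mul_mem m hm n hn =>
      obtain ⟨c, d, rfl⟩ := Ideal.mem_span_pair.1 hm
      obtain ⟨e, f, rfl⟩ := Ideal.mem_span_pair.1 hn
      exact ⟨c * e, c * f + d * e, d * f, by ring⟩
    | add x _ y _ hx hy =>
      obtain ⟨u, v, w, rfl⟩ := hx
      obtain ⟨u', v', w', rfl⟩ := hy
      exact ⟨u + u', v + v', w + w', by ring⟩
  · rintro ⟨u, v, w, rfl⟩
    have ha : a ∈ Ideal.span {a, b} := Ideal.subset_span (by simp)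
    have hb : b ∈ Ideal.span {a, b} := Ideal.subset_span (by simp)
    refine add_mem (add_mem ?_ ?_) ?_ <;> refine Ideal.mul_mem_right _ _ ?_
    · exact Ideal.pow_mem_pow ha 2
    · rw [pow_two]; exact Ideal.mul_mem_mul ha hb
    · exact Ideal.pow_mem_pow hb 2

theorem Polynomial.map_castRingHom_zmod_eq_zero_iff (p : ℕ) (g : ℤ[X]) :
    g.map (Int.castRingHom (ZMod p)) = 0 ↔ (p : ℤ[X]) ∣ g := by
  rw [show (p : ℤ[X]) = C (p : ℤ) by simp, C_dvd_iff_dvd_coeff, Polynomial.ext_iff]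
  simp [ZMod.intCast_zmod_eq_zero_iff_dvd]

/-! ### Maximal ideals of ℤ[X] containing a monic polynomial -/

section MaximalIdeals

variable {N : Ideal ℤ[X]} [hN : N.IsMaximal]

/-- If the residue field had characteristic zero, it would be an integral extension of ℤ, since `F`
makes the class of X integral; then ℤ would be a field. -/
theorem exists_prime_mem_of_monic_mem {F : ℤ[X]} (hF : F.Monic) (h : F ∈ N) :
    ∃ p : ℕ, p.Prime ∧ (p : ℤ[X]) ∈ N := by
  let := Ideal.Quotient.field N
  obtain ⟨p, hp⟩ := CharP.exists (ℤ[X] ⧸ N)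
  rcases CharP.char_is_prime_or_zero (ℤ[X] ⧸ N) p with h0 | h0
  · refine ⟨p, h0, ?_⟩
    rw [← Ideal.Quotient.eq_zero_iff_mem, map_natCast]
    exact CharP.cast_eq_zero _ _
  · subst h0
    have : CharZero (ℤ[X] ⧸ N) := CharP.charP_to_charZero _
    have hx : IsIntegral ℤ (Ideal.Quotient.mk N X) := by
      refine ⟨F, hF, ?_⟩
      have : eval₂ (algebraMap ℤ (ℤ[X] ⧸ N)) (Ideal.Quotient.mk N X) F =
          Ideal.Quotient.mk N F := by
        conv_rhs => rw [← eval₂_C_X (p := F), hom_eval₂]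
        congr 1
      rw [this, Ideal.Quotient.eq_zero_iff_mem]
      exact h
    have : Algebra.IsIntegral ℤ (ℤ[X] ⧸ N) := by
      refine ⟨fun y => ?_⟩
      obtain ⟨g, rfl⟩ := Ideal.Quotient.mk_surjective y
      induction g using Polynomial.induction_on' with
      | add f g hf hg => rw [map_add]; exact hf.add hg
      | monomial n a =>
        rw [← C_mul_X_pow_eq_monomial, map_mul, map_pow]
        exact (isIntegral_algebraMap (R := ℤ) (x := a)).mul (hx.pow n)
    have := isField_of_isIntegral_of_isField (R := ℤ) (S := ℤ[X] ⧸ N)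
      (RingHom.injective_int _) (Field.toIsField _)
    exact absurd this Int.not_isField

theorem exists_eq_span_pair {F : ℤ[X]} (hF : F.Monic) (h : F ∈ N) {p : ℕ} (hp : p.Prime)
    (hpN : (p : ℤ[X]) ∈ N) :
    ∃ φ : ℤ[X], N = Ideal.span {(p : ℤ[X]), φ} ∧
      Irreducible (φ.map (Int.castRingHom (ZMod p))) := by
  have := Fact.mk hp
  set π := mapRingHom (Int.castRingHom (ZMod p)) with hπ
  have hs : Function.Surjective π := map_surjective _ (ZMod.ringHom_surjective _)
  have hker : RingHom.ker π ≤ N := by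
    intro g hg
    exact N.mem_of_dvd ((map_castRingHom_zmod_eq_zero_iff p g).1 hg) hpN
  have hcomap : (N.map π).comap π = N := by
    rw [Ideal.comap_map_of_surjective' _ hs]
    exact sup_eq_left.2 hker
  obtain ⟨ψ, hψ⟩ := (IsPrincipalIdealRing.principal (N.map π)).principal
  obtain ⟨φ, rfl⟩ := hs ψ
  rw [← Ideal.span] at hψ
  have hmem (x : ℤ[X]) : x ∈ N ↔ π φ ∣ π x := by
    rw [← Ideal.mem_span_singleton, ← hψ, ← Ideal.mem_comap, hcomap]
  refine ⟨φ, le_antisymm ?_ ?_, ?_⟩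
  · intro x hx
    obtain ⟨c, hc⟩ := (hmem x).1 hx
    obtain ⟨c, rfl⟩ := hs c
    have : (p : ℤ[X]) ∣ x - φ * c := by
      rw [← map_castRingHom_zmod_eq_zero_iff]
      change π (x - φ * c) = 0
      rw [map_sub, map_mul, hc, sub_self]
    obtain ⟨d, hd⟩ := this
    exact Ideal.mem_span_pair.2 ⟨d, c, by linear_combination -hd⟩
  · rw [Ideal.span_le]
    rintro x (rfl | rfl)
    · exact hpN
    · exact (hmem _).2 dvd_rfl
  · have h0 : π φ ≠ 0 := by
      intro h0
      have := (hmem F).1 h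
      rw [h0, zero_dvd_iff] at this
      exact (hF.map (Int.castRingHom (ZMod p))).ne_zero this
    have hmax : (N.map π).IsMaximal := by
      refine (Ideal.map_eq_top_or_isMaximal_of_surjective π hs hN).resolve_left fun ht => ?_
      rw [ht, Ideal.comap_top] at hcomap
      exact hN.ne_top hcomap.symm
    have := hmax.isPrime
    rw [hψ, Ideal.span_singleton_prime h0] at this
    exact this.irreducible

/-- Here p is part of a regular system of parameters (p, φ): reducing pb = p²u + pφv + φ²w mod p
forces p ∣ w, and p cancels. -/
theorem mem_of_prime_mul_mem_sq {F : ℤ[X]} (hF : F.Monic) (h : F ∈ N) {p : ℕ} (hp : p.Prime)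
    (hpN : (p : ℤ[X]) ∈ N) {b : ℤ[X]} (hb : p * b ∈ N ^ 2) : b ∈ N := by
  obtain ⟨φ, hNφ, hφ⟩ := exists_eq_span_pair hF h hp hpN
  have := Fact.mk hp
  rw [hNφ] at hb
  obtain ⟨u, v, w, hw⟩ := Ideal.mem_span_pair_sq.1 hb
  have hp0 : (p : ℤ[X]) ≠ 0 := by exact_mod_cast hp.ne_zero
  have hpw : (p : ℤ[X]) ∣ w := by
    rw [← map_castRingHom_zmod_eq_zero_iff]
    have h1 : (φ ^ 2 * w).map (Int.castRingHom (ZMod p)) = 0 :=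
      (map_castRingHom_zmod_eq_zero_iff _ _).2 ⟨b - p * u - φ * v, by linear_combination -hw⟩
    rw [Polynomial.map_mul, Polynomial.map_pow] at h1
    exact (mul_eq_zero.1 h1).resolve_left (pow_ne_zero _ hφ.ne_zero)
  obtain ⟨w, rfl⟩ := hpw
  rw [hNφ]
  exact Ideal.mem_span_pair.2 ⟨u, v + φ * w, mul_left_cancel₀ hp0 (by linear_combination -hw)⟩

end MaximalIdeals

/-! ### The criterion: index one iff `F` lies in no N² -/

theorem aeval_rootOf_eq (F g : ℤ[X]) :
    aeval (rootOf F) g = AdjoinRoot.mk _ (g.map (Int.castRingHom ℚ)) := by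
  rw [← AdjoinRoot.aeval_eq]
  exact (aeval_map_algebraMap ℚ (rootOf F) g).symm

theorem aeval_rootOf_eq_zero_iff {F : ℤ[X]} (hF : F.Monic) (g : ℤ[X]) :
    aeval (rootOf F) g = 0 ↔ F ∣ g := by
  rw [aeval_rootOf_eq, AdjoinRoot.mk_eq_zero]
  exact map_dvd_map _ (RingHom.injective_int _) hF

theorem exists_int_mul_eq_aeval_rootOf (F : ℤ[X]) (z : RootField F) :
    ∃ n : ℤ, n ≠ 0 ∧ ∃ g : ℤ[X], (n : RootField F) * z = aeval (rootOf F) g := by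
  obtain ⟨q, rfl⟩ := AdjoinRoot.mk_surjective z
  obtain ⟨b, hb, hbq⟩ := IsLocalization.integerNormalization_spec (nonZeroDivisors ℤ) q
  refine ⟨b, nonZeroDivisors.ne_zero hb,
    IsLocalization.integerNormalization (nonZeroDivisors ℤ) q, ?_⟩
  rw [algebraMap_int_eq] at hbq
  rw [aeval_rootOf_eq, hbq, zsmul_eq_mul, map_mul, map_intCast]

theorem mem_adjoin_singleton_int_iff {L : Type*} [CommRing L] (a x : L) :
    x ∈ Algebra.adjoin ℤ {a} ↔ ∃ g : ℤ[X], aeval a g = x := by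
  rw [Algebra.adjoin_singleton_eq_range_aeval]
  rfl

theorem polyIndex_eq_one_iff (F : ℤ[X]) :
    polyIndex F = 1 ↔ ∀ x : RootField F, IsIntegral ℤ x → ∃ g : ℤ[X], aeval (rootOf F) g = x := by
  rw [polyIndex, AddSubgroup.relIndex_eq_one]
  refine forall_congr' fun x => ?_
  exact imp_congr Iff.rfl (mem_adjoin_singleton_int_iff _ _)

theorem isIntegral_rootOf {F : ℤ[X]} (hF : F.Monic) : IsIntegral ℤ (rootOf F) :=
  ⟨F, hF, (aeval_rootOf_eq_zero_iff hF F).2 dvd_rfl⟩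

theorem Ideal.exists_eq_mul_add_mul_of_mem_sq {R : Type*} [CommRing R] {a b x : R}
    (h : x ∈ Ideal.span {a, b} ^ 2) :
    ∃ u ∈ Ideal.span {a, b}, ∃ v ∈ Ideal.span {a, b}, x = a * u + b * v := by
  obtain ⟨u, v, w, rfl⟩ := Ideal.mem_span_pair_sq.1 h
  exact ⟨a * u + b * v, Ideal.mem_span_pair.2 ⟨u, v, by ring⟩, b * w,
    Ideal.mem_span_pair.2 ⟨0, w, by ring⟩, by ring⟩

/-- Write F = pu + φv with u, v ∈ N. Then v(θ)/p maps the module (p, φ(θ)) into itself, so it is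
integral. If it were in ℤ[θ], then v ≡ Fc ≡ φvc mod p would make φ a unit mod p. -/
theorem polyIndex_ne_one_of_mem_sq {F : ℤ[X]} (hF : F.Monic)
    (hirr : Irreducible (F.map (Int.castRingHom ℚ))) {N : Ideal ℤ[X]} [N.IsMaximal]
    (h : F ∈ N ^ 2) : polyIndex F ≠ 1 := by
  have := Fact.mk hirr
  have hFN : F ∈ N := Ideal.pow_le_self two_ne_zero h
  obtain ⟨p, hp, hpN⟩ := exists_prime_mem_of_monic_mem hF hFN
  obtain ⟨φ, hNφ, hφ⟩ := exists_eq_span_pair hF hFN hp hpN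
  have := Fact.mk hp
  rw [hNφ] at h
  obtain ⟨u, hu, v, hv, hFuv⟩ := Ideal.exists_eq_mul_add_mul_of_mem_sq h
  intro hidx
  rw [polyIndex_eq_one_iff] at hidx
  set a := rootOf F with ha
  have hp0 : (p : RootField F) ≠ 0 := by
    have : CharZero (RootField F) := algebraRat.charZero _
    exact_mod_cast hp.ne_zero
  set A := Algebra.adjoin ℤ {a} with hA
  have hgA (g : ℤ[X]) : aeval a g ∈ A := (mem_adjoin_singleton_int_iff _ _).2 ⟨g, rfl⟩
  let M : Submodule A (RootField F) := Submodule.span A {(p : RootField F), aeval a φ}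
  have hM (g : ℤ[X]) (hg : g ∈ Ideal.span {(p : ℤ[X]), φ}) : aeval a g ∈ M := by
    obtain ⟨c, d, rfl⟩ := Ideal.mem_span_pair.1 hg
    refine Submodule.mem_span_pair.2 ⟨⟨_, hgA c⟩, ⟨_, hgA d⟩, ?_⟩
    simp [Algebra.smul_def]
  have hF0 : aeval a F = 0 := (aeval_rootOf_eq_zero_iff hF F).2 dvd_rfl
  have hy : IsIntegral A (aeval a v / (p : RootField F)) := by
    refine isIntegral_of_smul_mem_submodule M ?_ (Submodule.fg_span (by simp)) _ ?_
    · intro hbot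
      have : (p : RootField F) ∈ M := Submodule.subset_span (by simp)
      rw [hbot, Submodule.mem_bot] at this
      exact hp0 this
    · intro n hn
      obtain ⟨c, d, rfl⟩ := Submodule.mem_span_pair.1 hn
      have h1 : (aeval a v / (p : RootField F)) * p = aeval a v := by field_simp
      have h2 : (aeval a v / (p : RootField F)) * aeval a φ = - aeval a u := by
        have h3 := congrArg (aeval a) hFuv
        simp only [map_add, map_mul, map_natCast, hF0] at h3
        field_simp
        linear_combination -h3
      rw [smul_add, smul_comm, smul_comm _ d, smul_eq_mul, smul_eq_mul, h1, h2]
      exact add_mem (M.smul_mem _ (hM _ hv)) (M.smul_mem _ (neg_mem (hM _ hu)))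
  have : Algebra.IsIntegral ℤ A := by
    rw [hA]
    exact Algebra.IsIntegral.adjoin (by rintro x rfl; exact isIntegral_rootOf hF)
  obtain ⟨g, hg⟩ := hidx _ (isIntegral_trans _ hy)
  have hdvd : F ∣ v - p * g := by
    rw [← aeval_rootOf_eq_zero_iff hF, map_sub, map_mul, map_natCast, ← ha, hg]
    field_simp
    ring
  obtain ⟨c, hc⟩ := hdvd
  set π := mapRingHom (Int.castRingHom (ZMod p)) with hπ
  have hπp : π (p : ℤ[X]) = 0 := (map_castRingHom_zmod_eq_zero_iff p _).2 dvd_rfl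
  have h1 : π F = π φ * π v := by
    rw [hFuv, map_add, map_mul, map_mul, hπp]
    ring
  have h2 : π v = π F * π c := by
    rw [← map_mul, ← hc, map_sub, map_mul, hπp]
    ring
  have hF1 : π F ≠ 0 := (hF.map (Int.castRingHom (ZMod p))).ne_zero
  have hv1 : π v ≠ 0 := fun h0 => hF1 (by rw [h1, h0, mul_zero])
  refine hφ.not_isUnit (IsUnit.of_mul_eq_one (π c) (mul_right_cancel₀ hv1 ?_))
  change π φ * π c * π v = 1 * π v
  rw [h1] at h2
  linear_combination -h2

theorem maximalIdeal_localization_isPrincipal {R : Type*} [CommRing R] {P : Ideal R} [P.IsPrime]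
    {s t u v : R} (hP : P = Ideal.span {s, t}) (h : s * u + t * v = 0) (hu : u ∉ P) :
    (IsLocalRing.maximalIdeal (Localization.AtPrime P)).IsPrincipal := by
  set f := algebraMap R (Localization.AtPrime P)
  obtain ⟨c, hc⟩ := (IsLocalization.map_units (Localization.AtPrime P)
    (⟨u, hu⟩ : P.primeCompl)).exists_left_inv
  change c * f u = 1 at hc
  refine ⟨⟨f t, ?_⟩⟩
  have hmap : IsLocalRing.maximalIdeal (Localization.AtPrime P) = Ideal.span {f s, f t} := by
    rw [← Localization.AtPrime.map_eq_maximalIdeal]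
    exact (congrArg (Ideal.map f) hP).trans (by rw [Ideal.map_span, Set.image_pair])
  rw [hmap]
  refine Ideal.span_pair_eq_span_right_iff_dvd.2 ⟨- f v * c, ?_⟩
  have h' := congrArg f h
  simp only [map_add, map_mul, map_zero] at h'
  linear_combination c * h' - f s * hc

/-- A nonzero prime P of ℤ[θ] pulls back to N = (p, φ), and F = up + vφ ∉ N² puts u or v outside N.
That coefficient is a unit in the localization, so the relation up + vφ = 0 leaves one generator:
every local ring is a DVR, and ℤ[θ] is integrally closed. -/
theorem polyIndex_eq_one_of_forall_notMem_sq {F : ℤ[X]} (hF : F.Monic)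
    (hirr : Irreducible (F.map (Int.castRingHom ℚ)))
    (h : ∀ N : Ideal ℤ[X], N.IsMaximal → F ∉ N ^ 2) : polyIndex F = 1 := by
  have := Fact.mk hirr
  have : CharZero (RootField F) := algebraRat.charZero _
  rw [polyIndex_eq_one_iff]
  set a := rootOf F with ha
  set A := Algebra.adjoin ℤ {a} with hA
  let π : ℤ[X] →+* A := (aeval a).toRingHom.codRestrict A
    fun g => (mem_adjoin_singleton_int_iff _ _).2 ⟨g, rfl⟩
  have hπ : Function.Surjective π := by
    rintro ⟨x, hx⟩
    obtain ⟨g, rfl⟩ := (mem_adjoin_singleton_int_iff _ _).1 hx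
    exact ⟨g, rfl⟩
  have hπF : π F = 0 := Subtype.ext ((aeval_rootOf_eq_zero_iff hF F).2 dvd_rfl)
  have : IsNoetherianRing A := isNoetherianRing_of_surjective _ _ π hπ
  have : Algebra.IsIntegral ℤ A := by
    rw [hA]
    exact Algebra.IsIntegral.adjoin (by rintro x rfl; exact isIntegral_rootOf hF)
  have hdim : Ring.DimensionLEOne A := Ring.DimensionLEOne.of_isIntegral ℤ A
  have hdvr : IsDedekindDomainDvr A := by
    refine { is_dvr_at_nonzero_prime := fun P hP0 hP => ?_ }
    have hPm : P.IsMaximal := hP.isMaximal hP0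
    have hN : (P.comap π).IsMaximal := Ideal.comap_isMaximal_of_surjective π hπ
    have hFN : F ∈ P.comap π := by rw [Ideal.mem_comap, hπF]; exact zero_mem _
    obtain ⟨p, hp, hpN⟩ := exists_prime_mem_of_monic_mem hF hFN
    obtain ⟨φ, hNφ, hφ⟩ := exists_eq_span_pair hF hFN hp hpN
    have hPspan : P = Ideal.span {π p, π φ} := by
      rw [← Ideal.map_comap_of_surjective π hπ P, hNφ, Ideal.map_span, Set.image_pair]
    obtain ⟨u, v, huv⟩ : ∃ u v, u * p + v * φ = F := by
      rw [hNφ] at hFN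
      exact Ideal.mem_span_pair.1 hFN
    have hrel : π p * π u + π φ * π v = 0 := by
      have h1 := congrArg π huv
      rw [map_add, map_mul, map_mul, hπF] at h1
      linear_combination h1
    have hprinc : (IsLocalRing.maximalIdeal (Localization.AtPrime P)).IsPrincipal := by
      by_cases hu : π u ∈ P
      · by_cases hv : π v ∈ P
        · refine absurd ?_ (h _ hN)
          rw [pow_two]
          have hφN : φ ∈ P.comap π := by
            rw [hNφ]
            exact Ideal.subset_span (by simp)
          have h1 := add_mem (Ideal.mul_mem_mul (I := P.comap π) hu hpN)
            (Ideal.mul_mem_mul (I := P.comap π) hv hφN)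
          exact (congrArg (· ∈ P.comap π * P.comap π) huv).mp h1
        · exact maximalIdeal_localization_isPrincipal (s := π φ) (t := π p) (v := π u)
            (by rw [Set.pair_comm]; exact hPspan)
            (by linear_combination hrel) hv
      · exact maximalIdeal_localization_isPrincipal hPspan hrel hu
    have : IsDomain (Localization.AtPrime P) :=
      IsLocalization.isDomain_localization P.primeCompl_le_nonZeroDivisors
    have : IsNoetherianRing (Localization.AtPrime P) :=
      IsLocalization.isNoetherianRing P.primeCompl _ inferInstance
    exact ((IsDiscreteValuationRing.TFAE _
      (IsLocalization.AtPrime.not_isField A hP0 _)).out 4 0).1 hprinc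
  have : IsFractionRing A (RootField F) := by
    refine IsFractionRing.of_field A _ fun z => ?_
    obtain ⟨n, hn, g, hg⟩ := exists_int_mul_eq_aeval_rootOf F z
    refine ⟨π g, (n : A), ?_⟩
    have hn' : (n : RootField F) ≠ 0 := by exact_mod_cast hn
    rw [map_intCast, eq_div_iff hn', mul_comm, hg]
    rfl
  intro x hx
  obtain ⟨y, hy⟩ := IsIntegrallyClosed.isIntegral_iff.1 (hx.tower_top (A := A))
  exact (mem_adjoin_singleton_int_iff _ _).1 (hy ▸ y.2)

theorem polyIndex_eq_one_iff_forall_notMem_sq {F : ℤ[X]} (hF : F.Monic)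
    (hirr : Irreducible (F.map (Int.castRingHom ℚ))) :
    polyIndex F = 1 ↔ ∀ N : Ideal ℤ[X], N.IsMaximal → F ∉ N ^ 2 :=
  ⟨fun h _ _ hFN => polyIndex_ne_one_of_mem_sq hF hirr hFN h,
    polyIndex_eq_one_of_forall_notMem_sq hF hirr⟩

/-- The cofactor of x - y is congruent to p·y^(p-1), hence to 0, modulo `N`. -/
theorem pow_sub_pow_mem_sq {R : Type*} [CommRing R] {N : Ideal R} {p : ℕ} {x y : R}
    (hp : (p : R) ∈ N) (h : x - y ∈ N) : x ^ p - y ^ p ∈ N ^ 2 := by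
  rw [← geom_sum₂_mul, pow_two]
  refine Ideal.mul_mem_mul ?_ h
  have hxy : Ideal.Quotient.mk N x = Ideal.Quotient.mk N y := Ideal.Quotient.eq.2 h
  have hp' : (p : R ⧸ N) = 0 := by
    rw [← map_natCast (Ideal.Quotient.mk N), Ideal.Quotient.eq_zero_iff_mem]
    exact hp
  rw [← Ideal.Quotient.eq_zero_iff_mem, map_sum]
  simp only [map_mul, map_pow, hxy]
  rw [geom_sum₂_self, hp', zero_mul]

/-! ### Basic facts on the simplest cubic -/

section SimplestCubic

variable (m : ℤ)

theorem aeval_simplestCubic {R : Type*} [CommRing R] (x : R) :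
    aeval x (simplestCubic m) = x ^ 3 - m * x ^ 2 - (m + 3) * x - 1 := by
  rw [simplestCubic, C_add, C_ofNat]
  simp [map_ofNat]

theorem eval₂_simplestCubic {R : Type*} [CommRing R] (f : ℤ →+* R) (x : R) :
    eval₂ f x (simplestCubic m) = x ^ 3 - m * x ^ 2 - (m + 3) * x - 1 := by
  simp only [simplestCubic, eval₂_sub, eval₂_mul, eval₂_pow, eval₂_X, eval₂_C, eval₂_one]
  rw [eq_intCast f, eq_intCast f]
  push_cast
  rfl

theorem expand_simplestCubic (k : ℕ) : expand ℤ k (simplestCubic m) =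
    (X ^ k) ^ 3 - (m : ℤ[X]) * (X ^ k) ^ 2 - ((m : ℤ[X]) + 3) * X ^ k - 1 := by
  rw [simplestCubic, C_add, C_ofNat]
  simp [map_ofNat, ← pow_mul]

theorem monic_simplestCubic : (simplestCubic m).Monic := by
  unfold simplestCubic
  monicity!

theorem natDegree_simplestCubic : (simplestCubic m).natDegree = 3 := by
  unfold simplestCubic
  compute_degree!

theorem exists_root_of_not_irreducible {p : ℕ} [Fact p.Prime]
    (h : ¬ Irreducible ((simplestCubic m).map (Int.castRingHom (ZMod p)))) :
    ∃ r : ZMod p, r ^ 3 - m * r ^ 2 - (m + 3) * r - 1 = 0 := by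
  contrapose! h
  refine irreducible_of_degree_le_three_of_not_isRoot ?_ fun x hx => h x ?_
  · rw [(monic_simplestCubic m).natDegree_map, natDegree_simplestCubic]
    simp
  · rw [IsRoot, eval_map, eval₂_simplestCubic] at hx
    exact hx

/-- Modulo 2 the cubic is x³ + x + 1 or x³ + x² + 1, neither of which has a root. -/
theorem irreducible_map_simplestCubic :
    Irreducible ((simplestCubic m).map (Int.castRingHom ℚ)) := by
  refine ((monic_simplestCubic m).irreducible_iff_irreducible_map_fraction_map (K := ℚ)).1 ?_
  refine (monic_simplestCubic m).irreducible_of_irreducible_map (Int.castRingHom (ZMod 2)) _ ?_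
  by_contra h
  obtain ⟨r, hr⟩ := exists_root_of_not_irreducible m h
  generalize (m : ZMod 2) = n at hr
  revert n r
  decide

end SimplestCubic

/-! ### Lifting maximal ideals along x ↦ x^k, and condition (ii) -/

theorem expand_isIntegral {k : ℕ} (hk : 0 < k) :
    (expand ℤ k : ℤ[X] →ₐ[ℤ] ℤ[X]).toRingHom.IsIntegral := by
  set f : ℤ[X] →+* ℤ[X] := (expand ℤ k : ℤ[X] →ₐ[ℤ] ℤ[X]).toRingHom
  have hC (a : ℤ) : f.IsIntegralElem (C a) := by
    rw [show C a = f (C a) from (expand_C k a).symm]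
    exact f.isIntegralElem_map
  intro g
  induction g using Polynomial.induction_on with
  | C a => exact hC a
  | add a b ha hb => exact RingHom.IsIntegralElem.add f ha hb
  | monomial n a h =>
    rw [pow_succ, ← mul_assoc]
    refine RingHom.IsIntegralElem.mul f h ⟨X ^ k - C X, monic_X_pow_sub_C _ hk.ne', ?_⟩
    rw [eval₂_sub, eval₂_X_pow, eval₂_C, sub_eq_zero]
    exact (expand_X k).symm

theorem exists_isMaximal_comap_expand {k : ℕ} (hk : 0 < k) (N : Ideal ℤ[X]) [hN : N.IsMaximal] :
    ∃ N' : Ideal ℤ[X], N'.IsMaximal ∧ N'.comap (expand ℤ k) = N := by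
  let f : ℤ[X] →+* ℤ[X] := (expand ℤ k : ℤ[X] →ₐ[ℤ] ℤ[X]).toRingHom
  have hf : f.IsIntegral := expand_isIntegral hk
  obtain ⟨P, hP⟩ := hf.comap_surjective (expand_injective hk) ⟨N, hN.isPrime⟩
  have hPN : P.asIdeal.comap f = N := congrArg PrimeSpectrum.asIdeal hP
  refine ⟨P.asIdeal, ?_, hPN⟩
  exact Ideal.isMaximal_of_isIntegral_of_isMaximal_comap' f hf P.asIdeal (hPN ▸ hN)

theorem exists_expand_mem_sq {k : ℕ} (hk : 0 < k) {N : Ideal ℤ[X]} [N.IsMaximal] {g : ℤ[X]}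
    (hg : g ∈ N ^ 2) : ∃ N' : Ideal ℤ[X], N'.IsMaximal ∧ expand ℤ k g ∈ N' ^ 2 := by
  obtain ⟨N', hN', rfl⟩ := exists_isMaximal_comap_expand hk N
  exact ⟨N', hN', Ideal.le_comap_pow (expand ℤ k) 2 hg⟩

theorem cast_sq_mem_sq {N : Ideal ℤ[X]} {p : ℕ} (hp : (p : ℤ[X]) ∈ N) {a : ℤ}
    (h : (p : ℤ) ^ 2 ∣ a) : (a : ℤ[X]) ∈ N ^ 2 := by
  obtain ⟨c, rfl⟩ := h
  push_cast
  exact Ideal.mul_mem_right _ _ (Ideal.pow_mem_pow hp 2)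

/-- If `z ≡ r` modulo an ideal `N` containing `p`, then `f(z^p) ≡ f(r^p)` modulo `N ^ 2`. -/
theorem simplestCubic_sub_mem_sq (m : ℤ) {N : Ideal ℤ[X]} {p : ℕ} (hp : (p : ℤ[X]) ∈ N)
    {z : ℤ[X]} {r : ℤ} (h : z - (r : ℤ[X]) ∈ N) :
    ((z ^ p) ^ 3 - (m : ℤ[X]) * (z ^ p) ^ 2 - (m + 3) * z ^ p - 1) -
      (((r ^ p) ^ 3 - m * (r ^ p) ^ 2 - (m + 3) * r ^ p - 1 : ℤ) : ℤ[X]) ∈ N ^ 2 := by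
  have h1 := Ideal.mul_mem_left _ ((z ^ p) ^ 2 + z ^ p * (r : ℤ[X]) ^ p + ((r : ℤ[X]) ^ p) ^ 2 -
    m * (z ^ p + (r : ℤ[X]) ^ p) - (m + 3)) (pow_sub_pow_mem_sq hp h)
  convert h1 using 1
  push_cast
  ring

/-- The maximal ideal of `ℤ[X]` generated by `p` and `X - r`. -/
def evalKer (p : ℕ) (r : ℤ) : Ideal ℤ[X] :=
  RingHom.ker (eval₂RingHom (Int.castRingHom (ZMod p)) (r : ZMod p))

theorem mem_evalKer {p : ℕ} {r : ℤ} {g : ℤ[X]} : g ∈ evalKer p r ↔ (p : ℤ) ∣ g.eval r := by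
  rw [evalKer, RingHom.mem_ker, ← ZMod.intCast_zmod_eq_zero_iff_dvd, coe_eval₂RingHom,
    ← eq_intCast (Int.castRingHom (ZMod p)) r, eval₂_at_apply]
  rfl

theorem isMaximal_evalKer {p : ℕ} (hp : p.Prime) (r : ℤ) : (evalKer p r).IsMaximal := by
  have := Fact.mk hp
  refine RingHom.ker_isMaximal_of_surjective _ fun x => ?_
  obtain ⟨a, rfl⟩ := ZMod.intCast_surjective x
  exact ⟨C a, by simp⟩

theorem natCast_mem_evalKer (p : ℕ) (r : ℤ) : (p : ℤ[X]) ∈ evalKer p r := by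
  simp [mem_evalKer]

theorem X_sub_mem_evalKer (p : ℕ) (r : ℤ) : X - (r : ℤ[X]) ∈ evalKer p r := by
  simp [mem_evalKer]

theorem exists_expand_simplestCubic_mem_sq {m : ℤ} {k p : ℕ} (hk : 0 < k) (hp : p.Prime)
    (hpk : p ∣ k) {r : ℤ}
    (h : (p : ℤ) ^ 2 ∣ (r ^ p) ^ 3 - m * (r ^ p) ^ 2 - (m + 3) * r ^ p - 1) :
    ∃ N : Ideal ℤ[X], N.IsMaximal ∧ expand ℤ k (simplestCubic m) ∈ N ^ 2 := by
  obtain ⟨l, rfl⟩ := hpk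
  have := isMaximal_evalKer hp r
  have h1 : expand ℤ p (simplestCubic m) ∈ evalKer p r ^ 2 := by
    have h2 := simplestCubic_sub_mem_sq m (natCast_mem_evalKer p r) (X_sub_mem_evalKer p r)
    rw [expand_simplestCubic]
    simpa using add_mem h2 (cast_sq_mem_sq (natCast_mem_evalKer p r) h)
  obtain ⟨N, hN, hmem⟩ := exists_expand_mem_sq (Nat.pos_of_mul_pos_left hk) h1
  refine ⟨N, hN, ?_⟩
  rwa [mul_comm, expand_mul]

/-- With u = r^p, f(u) = u³ - 3u - 1 - m·u(u + 1) is linear in m. Since u ≡ r mod p and the range of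
r excludes 0 and -1, u(u + 1) is a unit and `⁻¹` is a true inverse. -/
theorem ne_div_iff_not_dvd (m : ℤ) {p r : ℕ} (hp : p.Prime) (hr : 1 ≤ r) (hr' : r ≤ p - 2) :
    (m : ZMod (p ^ 2)) ≠
          ((r : ZMod (p ^ 2)) ^ (3 * p) - 3 * (r : ZMod (p ^ 2)) ^ p - 1) *
            ((r : ZMod (p ^ 2)) ^ p * ((r : ZMod (p ^ 2)) ^ p + 1))⁻¹ ↔
    ¬ (p : ℤ) ^ 2 ∣ ((r : ℤ) ^ p) ^ 3 - m * ((r : ℤ) ^ p) ^ 2 - (m + 3) * (r : ℤ) ^ p - 1 := by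
  have := Fact.mk hp
  have h1 : IsUnit ((r : ZMod (p ^ 2)) ^ p * ((r : ZMod (p ^ 2)) ^ p + 1)) := by
    have h2 : ((r ^ p * (r ^ p + 1) : ℕ) : ZMod (p ^ 2)) =
        (r : ZMod (p ^ 2)) ^ p * ((r : ZMod (p ^ 2)) ^ p + 1) := by push_cast; rfl
    rw [← h2, ZMod.isUnit_iff_coprime]
    refine Nat.Coprime.pow_right 2 (Nat.Coprime.symm ((Nat.Prime.coprime_iff_not_dvd hp).2 ?_))
    rw [← ZMod.natCast_eq_zero_iff]
    push_cast
    rw [ZMod.pow_card]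
    have h3 : (r : ZMod p) ≠ 0 := by
      rw [Ne, ZMod.natCast_eq_zero_iff]
      exact Nat.not_dvd_of_pos_of_lt hr (by omega)
    have h4 : (r : ZMod p) + 1 ≠ 0 := by
      rw [Ne, ← Nat.cast_one, ← Nat.cast_add, ZMod.natCast_eq_zero_iff]
      exact Nat.not_dvd_of_pos_of_lt (by omega) (by omega)
    exact mul_ne_zero h3 h4
  have h5 : (p : ℤ) ^ 2 = ((p ^ 2 : ℕ) : ℤ) := by push_cast; rfl
  rw [not_iff_not, h5, ← ZMod.intCast_zmod_eq_zero_iff_dvd]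
  have h6 := ZMod.mul_inv_of_unit _ h1
  push_cast
  set u := (r : ZMod (p ^ 2)) ^ p with hu
  rw [mul_comm 3 p, pow_mul, ← hu]
  constructor
  · intro h
    linear_combination (-(u * (u + 1))) * h - (u ^ 3 - 3 * u - 1) * h6
  · intro h
    linear_combination (-(u * (u + 1))⁻¹) * h - m * h6

/-! ### Descent of f(x^k) ∈ N², prime by prime -/

theorem derivative_mem_of_mem_sq {R : Type*} [CommRing R] {N : Ideal R[X]} {g : R[X]}
    (hg : g ∈ N ^ 2) : derivative g ∈ N := by
  rw [pow_two] at hg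
  induction hg using Submodule.mul_induction_on' with
  | mem_mul_mem a ha b hb =>
    rw [derivative_mul]
    exact add_mem (Ideal.mul_mem_left _ _ hb) (Ideal.mul_mem_right _ _ ha)
  | add x _ y _ hx hy => rw [derivative_add]; exact add_mem hx hy

theorem charP_quotient_of_prime_mem {R : Type*} [CommRing R] {N : Ideal R} [N.IsMaximal] {p : ℕ}
    (hp : p.Prime) (hpN : (p : R) ∈ N) : CharP (R ⧸ N) p := by
  obtain ⟨q, hq⟩ := CharP.exists (R ⧸ N)
  have h0 : (p : R ⧸ N) = 0 := by
    rw [← map_natCast (Ideal.Quotient.mk N), Ideal.Quotient.eq_zero_iff_mem]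
    exact hpN
  have hqp : q ∣ p := (CharP.cast_eq_zero_iff (R ⧸ N) q p).1 h0
  rcases (Nat.dvd_prime hp).1 hqp with rfl | rfl
  · exact absurd rfl (CharP.char_ne_one (R ⧸ N) 1)
  · exact hq

theorem intCast_mem_iff {R : Type*} [CommRing R] {N : Ideal R} [N.IsMaximal] {p : ℕ}
    (hp : p.Prime) (hpN : (p : R) ∈ N) (a : ℤ) : (a : R) ∈ N ↔ (p : ℤ) ∣ a := by
  have := charP_quotient_of_prime_mem hp hpN
  rw [← CharP.intCast_eq_zero_iff (R ⧸ N) p, ← map_intCast (Ideal.Quotient.mk N),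
    Ideal.Quotient.eq_zero_iff_mem]

theorem derivative_notMem_of_irreducible_map {p : ℕ} [Fact p.Prime] {M : Ideal ℤ[X]}
    [hM : M.IsMaximal] (hp : (p : ℤ[X]) ∈ M) {ψ : ℤ[X]} (hψ : ψ ∈ M)
    (hirr : Irreducible (ψ.map (Int.castRingHom (ZMod p)))) : derivative ψ ∉ M := by
  intro hd
  obtain ⟨a, b, hab⟩ : IsCoprime _ _ := PerfectField.separable_of_irreducible hirr
  have hs := map_surjective (Int.castRingHom (ZMod p)) (ZMod.ringHom_surjective _)
  obtain ⟨a, rfl⟩ := hs a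
  obtain ⟨b, rfl⟩ := hs b
  have h1 : (p : ℤ[X]) ∣ a * ψ + b * derivative ψ - 1 := by
    rw [← map_castRingHom_zmod_eq_zero_iff, Polynomial.map_sub, Polynomial.map_add,
      Polynomial.map_mul, Polynomial.map_mul, ← derivative_map, hab]
    simp
  refine hM.ne_top ((Ideal.eq_top_iff_one M).2 ?_)
  have h2 := sub_mem (add_mem (Ideal.mul_mem_left _ a hψ) (Ideal.mul_mem_left _ b hd))
    (M.mem_of_dvd h1 hp)
  simpa using h2

/-- Away from `0` and from the primes dividing `k`, the map `x ↦ x ^ k` is unramified. -/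
theorem mem_comap_expand_sq {k p : ℕ} (hk : 0 < k) (hp : p.Prime) (hpk : ¬ p ∣ k) {N : Ideal ℤ[X]}
    [hN : N.IsMaximal] (hpN : (p : ℤ[X]) ∈ N) (hX : X ∉ N) {f : ℤ[X]} (hf : f.Monic)
    (h : expand ℤ k f ∈ N ^ 2) : f ∈ (N.comap (expand ℤ k)) ^ 2 := by
  have := Fact.mk hp
  have hM : (N.comap (expand ℤ k)).IsMaximal :=
    Ideal.isMaximal_comap_of_isIntegral_of_isMaximal' _ (expand_isIntegral hk) N
  set M := N.comap (expand ℤ k) with hMdef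
  have hMmem (g : ℤ[X]) : g ∈ M ↔ expand ℤ k g ∈ N := Iff.rfl
  have hFN : expand ℤ k f ∈ N := Ideal.pow_le_self two_ne_zero h
  have hpM : (p : ℤ[X]) ∈ M := by rw [hMmem, map_natCast]; exact hpN
  obtain ⟨ψ, hMψ, hψ⟩ := exists_eq_span_pair hf ((hMmem f).2 hFN) hp hpM
  have hψM : ψ ∈ M := by rw [hMψ]; exact Ideal.subset_span (by simp)
  obtain ⟨d, c, hdc⟩ : ∃ d c, d * p + c * ψ = f := by
    have := (hMmem f).2 hFN
    rw [hMψ] at this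
    exact Ideal.mem_span_pair.1 this
  have hkN : (k : ℤ[X]) ∉ N := by
    have := (intCast_mem_iff hp hpN k).not
    push_cast at this
    rw [this]
    exact_mod_cast hpk
  -- The derivative of f(x^k) is f'(x^k)·k·x^(k-1), and neither k nor x lies in N.
  have hf' : derivative f ∈ M := by
    have h1 := derivative_mem_of_mem_sq h
    rw [derivative_expand] at h1
    refine (hN.isPrime.mem_or_mem h1).resolve_right fun h2 => ?_
    rcases hN.isPrime.mem_or_mem h2 with h3 | h3
    · exact hkN h3
    · exact hX (hN.isPrime.mem_of_pow_mem _ h3)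
  -- Modulo M, f' ≡ cψ', and ψ' ∉ M by separability.
  have hc : c ∈ M := by
    have h1 : c * derivative ψ ∈ M := by
      rw [← hdc] at hf'
      simp only [derivative_add, derivative_mul, derivative_natCast, mul_zero, add_zero] at hf'
      have h2 := sub_mem (sub_mem hf' (Ideal.mul_mem_left _ (derivative d) hpM))
        (Ideal.mul_mem_left _ (derivative c) hψM)
      convert h2 using 1
      ring
    exact (hM.isPrime.mem_or_mem h1).resolve_right
      (derivative_notMem_of_irreducible_map hpM hψM hψ)
  have hcψ : c * ψ ∈ M ^ 2 := by
    rw [pow_two]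
    exact Ideal.mul_mem_mul hc hψM
  -- Removing (cψ)(x^k) ∈ N² leaves p·d(x^k) ∈ N², where p cancels.
  have hd : d ∈ M := by
    refine mem_of_prime_mul_mem_sq (hf.expand hk) hFN hp hpN ?_
    have h1 : expand ℤ k (c * ψ) ∈ N ^ 2 := Ideal.le_comap_pow (expand ℤ k) 2 hcψ
    have h2 := sub_mem h h1
    rw [← hdc, map_add, add_sub_cancel_right, map_mul, map_natCast, mul_comm] at h2
    exact h2
  rw [← hdc]
  refine add_mem ?_ hcψ
  rw [pow_two]
  exact Ideal.mul_mem_mul hd hpM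

/-- The Galois group of the simplest cubic is generated by `r ↦ -(1 + r)⁻¹`, so a cubic with one
root over a field has all its roots there. -/
theorem exists_eq_map_of_simplestCubic_root {k L : Type*} [Field k] [Field L] (g : k →+* L) {m : ℤ}
    {s : k} (hs : s ^ 3 - m * s ^ 2 - (m + 3) * s - 1 = 0) {y : L}
    (hy : y ^ 3 - m * y ^ 2 - (m + 3) * y - 1 = 0) : ∃ r : k, g r = y := by
  have h0 : s ≠ 0 := by
    rintro rfl
    exact one_ne_zero (α := k) (by linear_combination -hs)
  have h1 : 1 + s ≠ 0 := by
    intro h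
    exact one_ne_zero (α := k)
      (by linear_combination hs - (s ^ 2 - (m + 1) * s - 2) * h)
  have hgs := congrArg g hs
  simp only [map_sub, map_mul, map_pow, map_add, map_intCast, map_ofNat, map_one, map_zero] at hgs
  have hg0 : g s ≠ 0 := by simpa using h0
  have hg1 : 1 + g s ≠ 0 := by
    rw [← map_one g, ← map_add]
    exact (map_ne_zero g).2 h1
  -- Eliminating m, s(s + 1)f(y) - y(y + 1)f(s) factors with roots s, -1/(1 + s) and -(1 + s)/s in
  -- y.
  have key : (y - g s) * (((1 + g s) * y + 1) * (g s * y + (1 + g s))) = 0 := by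
    linear_combination (g s * (1 + g s)) * hy - y * (y + 1) * hgs
  rcases mul_eq_zero.1 key with h | h
  · exact ⟨s, (sub_eq_zero.1 h).symm⟩
  rcases mul_eq_zero.1 h with h | h
  · refine ⟨-(1 + s)⁻¹, ?_⟩
    rw [map_neg, map_inv₀, map_add, map_one]
    field_simp
    linear_combination -h
  · refine ⟨-(1 + s) / s, ?_⟩
    rw [map_div₀, map_neg, map_add, map_one]
    field_simp
    linear_combination -h

theorem mk_expand_simplestCubic_eq_zero {m : ℤ} {k : ℕ} {N : Ideal ℤ[X]}
    (h : expand ℤ k (simplestCubic m) ∈ N) {y : ℤ[X] ⧸ N} (hy : y = Ideal.Quotient.mk N X ^ k) :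
    y ^ 3 - m * y ^ 2 - (m + 3) * y - 1 = 0 := by
  rw [← Ideal.Quotient.eq_zero_iff_mem, expand_simplestCubic] at h
  simpa only [map_sub, map_mul, map_pow, map_add, map_intCast, map_ofNat, map_one, ← hy] using h

theorem X_notMem_of_expand_simplestCubic_mem {m : ℤ} {k : ℕ} (hk : 0 < k) {N : Ideal ℤ[X]}
    [hN : N.IsMaximal] (h : expand ℤ k (simplestCubic m) ∈ N) : X ∉ N := by
  intro hX
  have h1 := mk_expand_simplestCubic_eq_zero h rfl
  rw [Ideal.Quotient.eq_zero_iff_mem.2 hX, zero_pow hk.ne'] at h1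
  have := Ideal.Quotient.field N
  exact one_ne_zero (α := ℤ[X] ⧸ N) (by linear_combination -h1)

/-- The class of x^k is a root of f in the residue field, so it is some r ∈ 𝔽_p. With k = pl,
injectivity of Frobenius gives x^l ≡ r mod N. Hence the integer f(r^p) lies in N², and p divides it
twice. -/
theorem exists_sq_dvd_of_expand_simplestCubic_mem_sq {m : ℤ} {k p : ℕ} (hk : 0 < k)
    (hp : p.Prime) (hpk : p ∣ k)
    (hred : ¬ Irreducible ((simplestCubic m).map (Int.castRingHom (ZMod p))))
    {N : Ideal ℤ[X]} [hN : N.IsMaximal] (hpN : (p : ℤ[X]) ∈ N)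
    (h : expand ℤ k (simplestCubic m) ∈ N ^ 2) :
    ∃ r : ℤ, (p : ℤ) ^ 2 ∣ (r ^ p) ^ 3 - m * (r ^ p) ^ 2 - (m + 3) * r ^ p - 1 := by
  have := Fact.mk hp
  let _ := Ideal.Quotient.field N
  have hchar := charP_quotient_of_prime_mem hp hpN
  obtain ⟨l, rfl⟩ := hpk
  have hFN := Ideal.pow_le_self two_ne_zero h
  obtain ⟨s, hs⟩ := exists_root_of_not_irreducible m hred
  obtain ⟨r, hr⟩ := exists_eq_map_of_simplestCubic_root (ZMod.castHom dvd_rfl (ℤ[X] ⧸ N)) hs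
    (mk_expand_simplestCubic_eq_zero hFN rfl)
  obtain ⟨r, rfl⟩ := ZMod.intCast_surjective r
  have hz : X ^ l - (r : ℤ[X]) ∈ N := by
    rw [← Ideal.Quotient.eq_zero_iff_mem, map_sub, map_pow, map_intCast]
    refine pow_eq_zero_iff hp.ne_zero |>.1 ?_
    rw [sub_pow_char, ← pow_mul, mul_comm l p, ← hr, map_intCast, sub_eq_zero]
    have := congrArg (ZMod.castHom dvd_rfl (ℤ[X] ⧸ N)) (ZMod.pow_card (r : ZMod p))
    rw [map_pow, map_intCast] at this
    exact this.symm
  have h1 := simplestCubic_sub_mem_sq m hpN hz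
  rw [← pow_mul X l p, mul_comm l p, ← expand_simplestCubic] at h1
  have h2 := (sub_mem h h1)
  rw [sub_sub_cancel] at h2
  refine ⟨r, ?_⟩
  obtain ⟨c, hc⟩ := (intCast_mem_iff hp hpN _).1 (Ideal.pow_le_self two_ne_zero h2)
  rw [hc] at h2 ⊢
  push_cast at h2
  have h3 := mem_of_prime_mul_mem_sq ((monic_simplestCubic m).expand hk) hFN hp hpN h2
  rw [pow_two]
  exact mul_dvd_mul_left _ ((intCast_mem_iff hp hpN _).1 h3)

/-- With z = x^l and k = 2l, f(z²) = f(z)² + 2d, so membership puts both f(z) and d in N. For each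
parity of m and e = m(m - 1)/2 these force z ≡ 0, against f(0) = -1. -/
theorem expand_simplestCubic_notMem_sq_of_two {m : ℤ} {k : ℕ} (hk : 0 < k) (h2k : 2 ∣ k)
    {N : Ideal ℤ[X]} [hN : N.IsMaximal] (h2N : ((2 : ℕ) : ℤ[X]) ∈ N) :
    expand ℤ k (simplestCubic m) ∉ N ^ 2 := by
  intro h
  let _ := Ideal.Quotient.field N
  have hFN := Ideal.pow_le_self two_ne_zero h
  obtain ⟨l, rfl⟩ := h2k
  obtain ⟨e, he⟩ : ∃ e : ℤ, m * (m - 1) = 2 * e := (Int.even_mul_pred_self m).two_dvd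
  have heX : (m : ℤ[X]) * (m - 1) = 2 * e := by exact_mod_cast congrArg (Int.cast (R := ℤ[X])) he
  set z : ℤ[X] := X ^ l with hz
  set f : ℤ[X] := z ^ 3 - m * z ^ 2 - (m + 3) * z - 1 with hf
  set d : ℤ[X] := m * z ^ 5 + (3 - e) * z ^ 4 - (m * (m + 3) - 1) * z ^ 3
    - (e + 5 * m + 6) * z ^ 2 - (m + 3) * z - 1 with hd
  have hF : expand ℤ (2 * l) (simplestCubic m) = f ^ 2 + (2 : ℕ) * d := by
    rw [expand_simplestCubic, mul_comm 2 l, pow_mul, ← hz, hf, hd]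
    push_cast
    linear_combination (z ^ 4 + z ^ 2) * (- heX)
  have hfN : f ∈ N := by
    refine hN.isPrime.mem_of_pow_mem 2 ?_
    rw [← add_sub_cancel_right (f ^ 2) ((2 : ℕ) * d), ← hF]
    exact sub_mem hFN (Ideal.mul_mem_right _ _ h2N)
  have hdN : d ∈ N := by
    refine mem_of_prime_mul_mem_sq ((monic_simplestCubic m).expand hk) hFN Nat.prime_two h2N ?_
    rw [← add_sub_cancel_left (f ^ 2) ((2 : ℕ) * d), ← hF]
    exact sub_mem h (Ideal.pow_mem_pow hfN 2)
  have h2 : (2 : ℤ[X] ⧸ N) = 0 := by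
    have := Ideal.Quotient.eq_zero_iff_mem.2 h2N
    rwa [map_natCast] at this
  rw [← Ideal.Quotient.eq_zero_iff_mem] at hfN hdN
  simp only [hf, hd, map_sub, map_mul, map_pow, map_add, map_intCast, map_ofNat, map_one]
    at hfN hdN
  generalize Ideal.Quotient.mk N z = w at hfN hdN
  have hcast (a : ℤ) : (a : ℤ[X] ⧸ N) = 0 ∨ (a : ℤ[X] ⧸ N) = 1 := by
    obtain ⟨b, rfl | rfl⟩ := Int.even_or_odd' a
    · left; push_cast; rw [h2, zero_mul]
    · right; push_cast; rw [h2, zero_mul, zero_add]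
  have hw : w = 0 := by
    rcases hcast m with hm | hm <;> rcases hcast e with he' | he' <;> rw [hm] at hfN hdN <;>
      rw [he'] at hdN
    · refine pow_eq_zero_iff (n := 4) (by norm_num) |>.1 ?_
      linear_combination hdN - hfN + (-w ^ 4 + 3 * w ^ 2) * h2
    · refine pow_eq_zero_iff (n := 2) (by norm_num) |>.1 ?_
      linear_combination hdN - hfN + (-w ^ 4 + 4 * w ^ 2) * h2
    · refine pow_eq_zero_iff (n := 2) (by norm_num) |>.1 ?_
      linear_combination hdN - (w ^ 2 + 1) * hfN + (-2 * w ^ 4 + 5 * w ^ 2) * h2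
    · refine pow_eq_zero_iff (n := 4) (by norm_num) |>.1 ?_
      linear_combination hdN - (w ^ 2 + 1) * hfN + (-w ^ 4 + 5 * w ^ 2) * h2
  rw [hw] at hfN
  exact one_ne_zero (α := ℤ[X] ⧸ N) (by linear_combination -hfN)

/-! ### Irreducibility of X^n - a -/

section PowSubC

open IntermediateField

universe u

variable {K : Type u} [Field K]

theorem isIntegral_of_minpoly_eq_X_pow_sub_C {E : Type*} [Field E] [Algebra K E] {n : ℕ}
    (hn : n ≠ 0) {a : K} {x : E} (hx : minpoly K x = X ^ n - C a) : IsIntegral K x :=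
  minpoly.ne_zero_iff.1 (hx ▸ (monic_X_pow_sub_C a hn).ne_zero)

theorem norm_gen_of_minpoly_eq_X_pow_sub_C {E : Type*} [Field E] [Algebra K E] {n : ℕ}
    (hn : n ≠ 0) {a : K} {x : E} (hx : minpoly K x = X ^ n - C a) :
    Algebra.norm K (AdjoinSimple.gen K x) = (-1) ^ n * -a := by
  have hint := isIntegral_of_minpoly_eq_X_pow_sub_C hn hx
  rw [← adjoin.powerBasis_gen hint, Algebra.PowerBasis.norm_gen_eq_coeff_zero_minpoly,
    adjoin.powerBasis_gen, adjoin.powerBasis_dim, minpoly_gen, hx, natDegree_X_pow_sub_C]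
  simp [hn.symm]

theorem norm_neg_gen_of_minpoly_eq_X_pow_sub_C {E : Type*} [Field E] [Algebra K E] {n : ℕ}
    (hn : n ≠ 0) {a : K} {x : E} (hx : minpoly K x = X ^ n - C a) :
    Algebra.norm K (-AdjoinSimple.gen K x) = -a := by
  have hint := isIntegral_of_minpoly_eq_X_pow_sub_C hn hx
  have h1 : Algebra.norm K (-1 : K⟮x⟯) = (-1) ^ n := by
    rw [← map_one (algebraMap K K⟮x⟯), ← map_neg, Algebra.norm_algebraMap, adjoin.finrank hint,
      hx, natDegree_X_pow_sub_C]
  rw [neg_eq_neg_one_mul, map_mul, h1, norm_gen_of_minpoly_eq_X_pow_sub_C hn hx, ← mul_assoc,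
    ← mul_pow]
  simp

theorem exists_ringHom_adjoin_apply_gen {E L : Type*} [Field E] [Algebra K E] [CommRing L]
    [Algebra K L] {x : E} (hx : IsIntegral K x) {y : L} (hy : aeval y (minpoly K x) = 0) :
    ∃ σ : K⟮x⟯ →+* L, σ (AdjoinSimple.gen K x) = y := by
  have h : aeval y (minpoly K (adjoin.powerBasis hx).gen) = 0 := by
    rw [adjoin.powerBasis_gen, minpoly_gen, hy]
  refine ⟨(adjoin.powerBasis hx).lift y h, ?_⟩
  rw [← adjoin.powerBasis_gen hx]
  exact (adjoin.powerBasis hx).lift_gen y h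

/-- Excluding both ±a as squares survives adjoining x = √a: since x and -x both have norm -a, b² =
±x would give N(b)² = -a. -/
theorem X_pow_two_pow_sub_C_irreducible (t : ℕ) {a : K} (h : ∀ b : K, b ^ 2 ≠ a)
    (h' : ∀ b : K, b ^ 2 ≠ -a) : Irreducible (X ^ 2 ^ t - C a) := by
  induction t generalizing K with
  | zero => simpa using irreducible_X_sub_C a
  | succ t ih =>
    rw [pow_succ]
    refine X_pow_mul_sub_C_irreducible (X_pow_sub_C_irreducible_of_prime Nat.prime_two h) ?_
    intro E _ _ x hx
    refine ih (fun b hb => h' (Algebra.norm K b) ?_) (fun b hb => h' (Algebra.norm K b) ?_)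
    · rw [← map_pow, hb, norm_gen_of_minpoly_eq_X_pow_sub_C two_ne_zero hx]
      ring
    · rw [← map_pow, hb, norm_neg_gen_of_minpoly_eq_X_pow_sub_C two_ne_zero hx]

/-- Split off the odd part l of n. If x^l = a with l odd, then ±x have norms ±a, so neither is a
square and the 2-power case applies over K(x). -/
theorem X_pow_sub_C_irreducible_of_not_sq {n : ℕ} (hn : n ≠ 0) {a : K} (h : ∀ b : K, b ^ 2 ≠ a)
    (h' : ∀ b : K, b ^ 2 ≠ -a) (ha : ∀ p : ℕ, p.Prime → Odd p → p ∣ n → ∀ b : K, b ^ p ≠ a) :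
    Irreducible (X ^ n - C a) := by
  obtain ⟨t, l, hl, rfl⟩ := Nat.exists_eq_two_pow_mul_odd hn
  refine X_pow_mul_sub_C_irreducible (X_pow_sub_C_irreducible_of_odd hl fun p hp hpl =>
    ha p hp (hl.of_dvd_nat hpl) (hpl.mul_left _)) ?_
  intro E _ _ x hx
  refine X_pow_two_pow_sub_C_irreducible t (fun b hb => h (Algebra.norm K b) ?_)
    (fun b hb => h' (Algebra.norm K b) ?_)
  · rw [← map_pow, hb, norm_gen_of_minpoly_eq_X_pow_sub_C hl.pos.ne' hx, hl.neg_one_pow]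
    ring
  · rw [← map_pow, hb, norm_neg_gen_of_minpoly_eq_X_pow_sub_C hl.pos.ne' hx]

end PowSubC

/-! ### Irreducibility of f(x^k) -/

section SimplestCubic

variable {m : ℤ}

/-- Sign changes: f(-1) = 1, f(0) = -1 and f(|m| + 3) ≥ 0. -/
theorem exists_real_root_simplestCubic (m : ℤ) :
    (∃ x : ℝ, x < 0 ∧ x ^ 3 - m * x ^ 2 - (m + 3) * x - 1 = 0) ∧
      ∃ x : ℝ, 0 < x ∧ x ^ 3 - m * x ^ 2 - (m + 3) * x - 1 = 0 := by
  have hc : Continuous fun x : ℝ => x ^ 3 - m * x ^ 2 - (m + 3) * x - 1 := by fun_prop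
  constructor
  · obtain ⟨x, hx, hx0⟩ := intermediate_value_Icc' (show (-1 : ℝ) ≤ 0 by norm_num)
      hc.continuousOn (show (0 : ℝ) ∈ _ by
        constructor <;> norm_num; linarith)
    refine ⟨x, lt_of_le_of_ne hx.2 ?_, hx0⟩
    rintro rfl
    norm_num at hx0
  · have hb : (0 : ℝ) ≤ |(m : ℝ)| + 3 := by positivity
    obtain ⟨x, hx, hx0⟩ := intermediate_value_Icc hb
      hc.continuousOn (show (0 : ℝ) ∈ _ by
        constructor
        · norm_num
        · have h1 := le_abs_self (m : ℝ)
          have h2 := abs_nonneg (m : ℝ)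
          set M := |(m : ℝ)|
          nlinarith [mul_nonneg (sub_nonneg.2 h1) (sq_nonneg (M + 3)),
            mul_nonneg (sub_nonneg.2 h1) (add_nonneg h2 zero_le_three), sq_nonneg M])
    refine ⟨x, lt_of_le_of_ne hx.1 ?_, hx0⟩
    rintro rfl
    norm_num at hx0

theorem exists_ringHom_rootField {R : Type*} [CommRing R] [Algebra ℚ R] {x : R}
    (hx : x ^ 3 - m * x ^ 2 - (m + 3) * x - 1 = 0) :
    ∃ σ : RootField (simplestCubic m) →+* R, σ (rootOf (simplestCubic m)) = x :=
  ⟨AdjoinRoot.lift (algebraMap ℚ R) x (by rw [eval₂_map, eval₂_simplestCubic, hx]),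
    AdjoinRoot.lift_root _⟩

theorem sq_ne_rootOf (b : RootField (simplestCubic m)) : b ^ 2 ≠ rootOf (simplestCubic m) := by
  intro hb
  obtain ⟨x, hx, hx0⟩ := (exists_real_root_simplestCubic m).1
  obtain ⟨σ, hσ⟩ := exists_ringHom_rootField hx0
  have h := congrArg σ hb
  rw [map_pow, hσ] at h
  linarith [sq_nonneg (σ b)]

theorem sq_ne_neg_rootOf (b : RootField (simplestCubic m)) :
    b ^ 2 ≠ -rootOf (simplestCubic m) := by
  intro hb
  obtain ⟨x, hx, hx0⟩ := (exists_real_root_simplestCubic m).2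
  obtain ⟨σ, hσ⟩ := exists_ringHom_rootField hx0
  have h := congrArg σ hb
  rw [map_pow, map_neg, hσ] at h
  linarith [sq_nonneg (σ b)]

theorem sq_dvd_eval_of_mem_evalKer_sq {p : ℕ} {r : ℤ} {g : ℤ[X]} (hg : g ∈ evalKer p r ^ 2) :
    (p : ℤ) ^ 2 ∣ g.eval r := by
  rw [pow_two] at hg
  induction hg using Submodule.mul_induction_on' with
  | mem_mul_mem a ha b hb =>
    rw [eval_mul, pow_two]
    exact mul_dvd_mul (mem_evalKer.1 ha) (mem_evalKer.1 hb)
  | add x _ y _ hx hy => rw [eval_add]; exact dvd_add hx hy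

theorem evalKer_congr {p : ℕ} {r s : ℤ} (h : (p : ℤ) ∣ r - s) : evalKer p r = evalKer p s := by
  have : (r : ZMod p) = (s : ZMod p) := by
    rw [← sub_eq_zero, ← Int.cast_sub, ZMod.intCast_zmod_eq_zero_iff_dvd]
    exact h
  rw [evalKer, evalKer, this]

theorem int_prime_dvd_pow_sub_self {p : ℕ} (hp : p.Prime) (s : ℤ) : (p : ℤ) ∣ s ^ p - s := by
  have := Fact.mk hp
  rw [← ZMod.intCast_zmod_eq_zero_iff_dvd]
  push_cast
  rw [ZMod.pow_card, sub_self]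

theorem eval_simplestCubic (m s : ℤ) :
    (simplestCubic m).eval s = s ^ 3 - m * s ^ 2 - (m + 3) * s - 1 := by
  simpa using aeval_simplestCubic m s

/-- If θ = b^p, then b is integral, so b = g(θ) and X - g^p = fc. Take a root r of f mod p, s = g(r)
and N = (p, X - r) = (p, X - s^p). Then g^p ≡ s^p mod N², so X - s^p - fc ∈ N². Evaluating at s^p
gives p² ∣ f(s^p)c(s^p); differentiating gives p ∤ c(s^p). Hence p² ∣ f(s^p). -/
theorem pow_ne_rootOf {p : ℕ} (hp : p.Prime) (hmon : polyIndex (simplestCubic m) = 1)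
    (hred : ¬ Irreducible ((simplestCubic m).map (Int.castRingHom (ZMod p))))
    (hsq : ∀ r : ℤ, ¬ (p : ℤ) ^ 2 ∣ (r ^ p) ^ 3 - m * (r ^ p) ^ 2 - (m + 3) * r ^ p - 1)
    (b : RootField (simplestCubic m)) : b ^ p ≠ rootOf (simplestCubic m) := by
  intro hb
  have := Fact.mk hp
  have hint : IsIntegral ℤ b :=
    IsIntegral.of_pow hp.pos (hb ▸ isIntegral_rootOf (monic_simplestCubic m))
  obtain ⟨g, rfl⟩ := (polyIndex_eq_one_iff _).1 hmon b hint
  set f := simplestCubic m with hf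
  obtain ⟨c, hc⟩ : f ∣ X - g ^ p := by
    rw [← aeval_rootOf_eq_zero_iff (monic_simplestCubic m), map_sub, map_pow, hb, aeval_X,
      sub_self]
  obtain ⟨r, hr⟩ := exists_root_of_not_irreducible m hred
  obtain ⟨r, rfl⟩ := ZMod.intCast_surjective r
  have hfr : (p : ℤ) ∣ f.eval r := by
    rw [hf, eval_simplestCubic, ← ZMod.intCast_zmod_eq_zero_iff_dvd]
    exact_mod_cast hr
  set s := g.eval r with hs
  have hrs : (p : ℤ) ∣ r - s ^ p := by
    have h1 := congrArg (eval r) hc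
    rw [eval_sub, eval_pow, eval_X, eval_mul] at h1
    rw [hs, h1]
    exact hfr.mul_right _
  have hrs' : (p : ℤ) ∣ r - s := by
    simpa using dvd_add hrs (int_prime_dvd_pow_sub_self hp s)
  have hgs : g - (s : ℤ[X]) ∈ evalKer p r := by
    rw [mem_evalKer]
    simp [hs]
  have hq : (X - ((s ^ p : ℤ) : ℤ[X])) - f * c ∈ evalKer p (s ^ p) ^ 2 := by
    rw [← evalKer_congr hrs]
    have h1 := pow_sub_pow_mem_sq (natCast_mem_evalKer p r) hgs
    convert h1 using 1
    push_cast
    linear_combination hc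
  have hfw : (p : ℤ) ∣ f.eval (s ^ p) := by
    rw [← mem_evalKer, ← evalKer_congr hrs, mem_evalKer]
    exact hfr
  have hfc : (p : ℤ) ^ 2 ∣ f.eval (s ^ p) * c.eval (s ^ p) := by
    have h1 := sq_dvd_eval_of_mem_evalKer_sq hq
    rw [eval_sub, eval_sub, eval_X, eval_intCast, Int.cast_id, sub_self, zero_sub, dvd_neg,
      eval_mul] at h1
    exact h1
  have hcw : ¬ (p : ℤ) ∣ c.eval (s ^ p) := by
    intro hcw
    have h1 := mem_evalKer.1 (derivative_mem_of_mem_sq hq)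
    rw [derivative_sub, derivative_sub, derivative_X, derivative_intCast, derivative_mul] at h1
    simp only [eval_sub, eval_add, eval_mul, eval_one, sub_zero] at h1
    have h2 := dvd_add h1 (dvd_add (hcw.mul_left (eval (s ^ p) (derivative f)))
      (hfw.mul_right (eval (s ^ p) (derivative c))))
    rw [sub_add_cancel] at h2
    exact (Nat.prime_iff_prime_int.1 hp).not_dvd_one h2
  refine hsq s ?_
  rw [← eval_simplestCubic]
  refine IsCoprime.dvd_of_dvd_mul_right ?_ hfc
  exact (((Nat.prime_iff_prime_int.1 hp).coprime_iff_not_dvd).2 hcw).pow_left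

theorem irreducible_map_expand_simplestCubic {k : ℕ} (hk : k ≠ 0)
    (h : ∀ p : ℕ, p.Prime → Odd p → p ∣ k → ∀ b : RootField (simplestCubic m),
      b ^ p ≠ rootOf (simplestCubic m)) :
    Irreducible ((expand ℤ k (simplestCubic m)).map (Int.castRingHom ℚ)) := by
  rw [map_expand, expand_eq_comp_X_pow]
  refine irreducible_comp ((monic_simplestCubic m).map _) (monic_X_pow k)
    (irreducible_map_simplestCubic m) ?_
  intro E _ _ x hx
  have hint : IsIntegral ℚ x :=
    minpoly.ne_zero_iff.1 (hx ▸ ((monic_simplestCubic m).map _).ne_zero)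
  -- The field ℚ(x) is abstract; σ carries powers in it to powers in `RootField`.
  obtain ⟨σ, hσ⟩ := exists_ringHom_adjoin_apply_gen hint (y := rootOf (simplestCubic m)) (by
    rw [hx]
    exact (aeval_map_algebraMap ℚ _ _).trans
      ((aeval_rootOf_eq_zero_iff (monic_simplestCubic m) _).2 dvd_rfl))
  rw [Polynomial.map_pow, map_X]
  refine X_pow_sub_C_irreducible_of_not_sq hk (fun b hb => sq_ne_rootOf (σ b) ?_)
    (fun b hb => sq_ne_neg_rootOf (σ b) ?_) (fun p hp hodd hpk b hb => h p hp hodd hpk (σ b) ?_)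
  · rw [← map_pow, hb, hσ]
  · rw [← map_pow, hb, map_neg, hσ]
  · rw [← map_pow, hb, hσ]

/-- Modulo p², f(r^p) depends only on r mod p; the classes 0 and -1 drop out because f(0) = -1 and
f(-1) = 1. -/
theorem forall_nat_not_sq_dvd_iff {p : ℕ} (hp : p.Prime) :
    (∀ r : ℕ, 1 ≤ r → r ≤ p - 2 →
      ¬ (p : ℤ) ^ 2 ∣ ((r : ℤ) ^ p) ^ 3 - m * ((r : ℤ) ^ p) ^ 2 - (m + 3) * (r : ℤ) ^ p - 1) ↔
    ∀ r : ℤ, ¬ (p : ℤ) ^ 2 ∣ (r ^ p) ^ 3 - m * (r ^ p) ^ 2 - (m + 3) * r ^ p - 1 := by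
  have := Fact.mk hp
  refine ⟨fun h r hr => ?_, fun h r _ _ => h r⟩
  set s := (r : ZMod p).val with hs
  have hsr : (s : ZMod p) = r := ZMod.natCast_zmod_val _
  have hps : (p : ℤ) ∣ s - r := by
    rw [← ZMod.intCast_zmod_eq_zero_iff_dvd]
    push_cast
    rw [hsr, sub_self]
  have hroot : (r : ZMod p) ^ 3 - m * (r : ZMod p) ^ 2 - (m + 3) * r - 1 = 0 := by
    have h1 := (ZMod.intCast_zmod_eq_zero_iff_dvd _ p).2
      ((dvd_pow_self (p : ℤ) two_ne_zero).trans hr)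
    push_cast at h1
    rwa [ZMod.pow_card] at h1
  have hr0 : (r : ZMod p) ≠ 0 := by
    intro h0
    rw [h0] at hroot
    exact one_ne_zero (α := ZMod p) (by linear_combination -hroot)
  have hr1 : (r : ZMod p) + 1 ≠ 0 := by
    intro h0
    refine one_ne_zero (α := ZMod p) ?_
    linear_combination hroot - ((r : ZMod p) ^ 2 - (m + 1) * r - 2) * h0
  have hs0 : s ≠ 0 := fun h0 => hr0 (by rw [← hsr, h0, Nat.cast_zero])
  have hs1 : s + 1 ≠ p := fun h0 => hr1 (by
    rw [← hsr, ← Nat.cast_one, ← Nat.cast_add, h0, ZMod.natCast_self])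
  have hsp : s < p := ZMod.val_lt _
  refine h s (by omega) (by omega) ?_
  have hpow : (p : ℤ) ^ 2 ∣ (s : ℤ) ^ p - r ^ p := by
    simpa using dvd_sub_pow_of_dvd_sub hps 1
  have h1 := dvd_add hr (hpow.mul_left (((s : ℤ) ^ p) ^ 2 + (s : ℤ) ^ p * r ^ p + (r ^ p) ^ 2 -
    m * ((s : ℤ) ^ p + r ^ p) - (m + 3)))
  rwa [show (s ^ p : ℤ) ^ 3 - m * (s ^ p) ^ 2 - (m + 3) * s ^ p - 1 =
    (r ^ p) ^ 3 - m * (r ^ p) ^ 2 - (m + 3) * r ^ p - 1 +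
      ((s ^ p) ^ 2 + s ^ p * r ^ p + (r ^ p) ^ 2 - m * (s ^ p + r ^ p) - (m + 3)) *
        (s ^ p - r ^ p) by ring]

end SimplestCubic

end

theorem proposition4p3 (m : ℤ) (k : ℕ) (hk : 0 < k)
    (hred : ∀ p : ℕ, p.Prime → Odd p → p ∣ k →
      ¬ Irreducible ((simplestCubic m).map (Int.castRingHom (ZMod p)))) :
    IsMonogenic (Polynomial.expand ℤ k (simplestCubic m)) ↔
      IsMonogenic (simplestCubic m) ∧
      ∀ p : ℕ, p.Prime → Odd p → p ∣ k → ∀ r : ℕ, 1 ≤ r → r ≤ p - 2 →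
        (m : ZMod (p ^ 2)) ≠
          ((r : ZMod (p ^ 2)) ^ (3 * p) - 3 * (r : ZMod (p ^ 2)) ^ p - 1) *
            ((r : ZMod (p ^ 2)) ^ p * ((r : ZMod (p ^ 2)) ^ p + 1))⁻¹ := by
  have hm := monic_simplestCubic m
  have hirr := irreducible_map_simplestCubic m
  constructor
  · rintro ⟨hM, hI, hidx⟩
    have hN := (polyIndex_eq_one_iff_forall_notMem_sq hM hI).1 hidx
    refine ⟨⟨hm, hirr, (polyIndex_eq_one_iff_forall_notMem_sq hm hirr).2 fun N _ hmem => ?_⟩, ?_⟩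
    · obtain ⟨N', hN', hmem'⟩ := exists_expand_mem_sq hk hmem
      exact hN N' hN' hmem'
    · intro p hp hodd hpk r hr hr'
      rw [ne_div_iff_not_dvd m hp hr hr']
      intro hdvd
      obtain ⟨N, hNm, hmem⟩ := exists_expand_simplestCubic_mem_sq hk hp hpk hdvd
      exact hN N hNm hmem
  · rintro ⟨⟨-, -, hidx⟩, hii⟩
    have hsq (p : ℕ) (hp : p.Prime) (hodd : Odd p) (hpk : p ∣ k) :=
      (forall_nat_not_sq_dvd_iff (m := m) hp).1 fun r hr hr' =>
        (ne_div_iff_not_dvd m hp hr hr').1 (hii p hp hodd hpk r hr hr')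
    have hI := irreducible_map_expand_simplestCubic (m := m) hk.ne' fun p hp hodd hpk =>
      pow_ne_rootOf hp hidx (hred p hp hodd hpk) (hsq p hp hodd hpk)
    refine ⟨hm.expand hk, hI,
      (polyIndex_eq_one_iff_forall_notMem_sq (hm.expand hk) hI).2 fun N hN hmem => ?_⟩
    have hFN := Ideal.pow_le_self two_ne_zero hmem
    obtain ⟨p, hp, hpN⟩ := exists_prime_mem_of_monic_mem (hm.expand hk) hFN
    by_cases hpk : p ∣ k
    · rcases hp.eq_two_or_odd' with rfl | hodd
      · exact expand_simplestCubic_notMem_sq_of_two hk hpk hpN hmem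
      · obtain ⟨r, hr⟩ := exists_sq_dvd_of_expand_simplestCubic_mem_sq hk hp hpk
          (hred p hp hodd hpk) hpN hmem
        exact hsq p hp hodd hpk r hr
    · have hcomap : (N.comap (Polynomial.expand ℤ k)).IsMaximal :=
        Ideal.isMaximal_comap_of_isIntegral_of_isMaximal' _ (expand_isIntegral hk) N
      exact (polyIndex_eq_one_iff_forall_notMem_sq hm hirr).1 hidx _ hcomap
        (mem_comap_expand_sq hk hp hpk hpN (X_notMem_of_expand_simplestCubic_mem hk hFN) hm hmem)
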